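/- Let $1<p<\infty$, let $m\ge 0$ be an integer, let $\Omega_1,\dots,\Omega_d\subset\mathbb{R}$ be open sets and let $\Omega=\Omega_1\times\dots\times\Omega_d\subset\mathbb{R}^d$. All functions take values in $\mathbb{K}=\mathbb{R}$ (or, equally, $\mathbb{K}=\mathbb{C}$). Let $$H^{m,p}(\Omega)=\{u\in L^p(\Omega): D^\alpha u\in L^p(\Omega)\ \text{for all multi-indices } \alpha\in\mathbb{N}^d \text{ with } |\alpha|\le m\},$$ where $D^\alpha=\partial_{x_1}^{\alpha_1}\cdots\partial_{x_d}^{\alpha_d}$ is the weak derivative, equipped with the norm $$\|u\|_{m,p}=\sum_{|\alpha|\le m}\|D^\alpha u\|_{L^p(\Omega)},$$ and let $H^{m,p}(\Omega_k)=\{w\in L^p(\Omega_k): w^{(j)}\in L^p(\Omega_k)\ \text{weakly, for } 0\le j\le m\}$. For $w^{(k)}\in H^{m,p}(\Omega_k)$ write $\big(\bigotimes_{k=1}^d w^{(k)}\big)(x_1,\dots,x_d)=\prod_{k=1}^d w^{(k)}(x_k)$. Then $\bigotimes_{k=1}^d w^{(k)}$ belongs to $H^{m,p}(\Omega)$ whenever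 $w^{(k)}\in H^{m,p}(\Omega_k)$ for all $k$, and the set of rank-one tensors $$\Big\{\bigotimes_{k=1}^d w^{(k)}: w^{(k)}\in H^{m,p}(\Omega_k),\ 1\le k\le d\Big\}$$ is weakly closed in $(H^{m,p}(\Omega),\|\cdot\|_{m,p})$, that is, closed in the weak topology $\sigma(H^{m,p}(\Omega),H^{m,p}(\Omega)^*)$. -/

import Mathlib

open MeasureTheory TopologicalSpace LineDeriv
open scoped ENNReal Distributions

noncomputable section

/-- The integration-by-parts identity behind weak derivatives: `v` is the weak derivative of `u` on
the open set `Ω` for a differential operator of order `n` that acts on test functions as `D`,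
i.e. `∫_Ω (D φ) u = (-1)^n ∫_Ω φ v` for every `φ ∈ C_c^∞(Ω)`. -/
def IsWeakDeriv {𝕜 : Type*} [RCLike 𝕜] {E : Type*} [NormedAddCommGroup E] [NormedSpace ℝ E]
    [MeasureSpace E] {Ω : Opens E} (D : 𝓓(Ω, ℝ) → 𝓓(Ω, ℝ)) (n : ℕ) (u v : E → 𝕜) : Prop :=
  ∀ φ : 𝓓(Ω, ℝ), ∫ x in (Ω : Set E), (D φ) x • u x = (-1) ^ n * ∫ x in (Ω : Set E), φ x • v x

/-- `D^α φ = ∂_{x_1}^{α_1} ⋯ ∂_{x_d}^{α_d} φ` for a test function `φ` on an open `Ω ⊆ ℝ^d`. -/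
def multiDeriv {d : ℕ} {Ω : Opens (Fin d → ℝ)} (α : Fin d → ℕ) (φ : 𝓓(Ω, ℝ)) : 𝓓(Ω, ℝ) :=
  (List.finRange d).foldr
    (fun k ψ => (fun η : 𝓓(Ω, ℝ) => ∂_{(Pi.single k 1 : Fin d → ℝ)} η)^[α k] ψ) φ

/-- The multi-indices `α ∈ ℕ^d` with `|α| ≤ m`. -/
def multiIndices (d m : ℕ) : Finset (Fin d → ℕ) :=
  {α ∈ Fintype.piFinset fun _ => Finset.range (m + 1) | ∑ k, α k ≤ m}

theorem mem_multiIndices {d m : ℕ} {α : Fin d → ℕ} : α ∈ multiIndices d m ↔ ∑ k, α k ≤ m := by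
  simp only [multiIndices, Finset.mem_filter, Fintype.mem_piFinset, Finset.mem_range,
    and_iff_right_iff_imp]
  intro h k
  have := Finset.single_le_sum (f := α) (fun _ _ => Nat.zero_le _) (Finset.mem_univ k)
  omega

section WeakDerivative

variable {𝕜 : Type*} [RCLike 𝕜] {E : Type*} [NormedAddCommGroup E] [NormedSpace ℝ E]
  [MeasureSpace E] {Ω : Opens E} {p : ℝ≥0∞}

theorem integrable_testFunction_smul [Fact (1 ≤ p)] [BorelSpace E]
    [IsLocallyFiniteMeasure (volume : Measure E)]
    (u : Lp 𝕜 p (volume.restrict (Ω : Set E))) (φ : 𝓓(Ω, ℝ)) :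
    Integrable (fun x => φ x • u x) (volume.restrict (Ω : Set E)) :=
  ((Lp.memLp u).locallyIntegrable Fact.out).integrable_smul_left_of_hasCompactSupport
    φ.continuous φ.hasCompactSupport

theorem IsWeakDeriv.add [Fact (1 ≤ p)] [BorelSpace E]
    [IsLocallyFiniteMeasure (volume : Measure E)]
    {D : 𝓓(Ω, ℝ) → 𝓓(Ω, ℝ)} {n : ℕ} {u u' v v' : Lp 𝕜 p (volume.restrict (Ω : Set E))}
    (h : IsWeakDeriv D n (u : E → 𝕜) v) (h' : IsWeakDeriv D n (u' : E → 𝕜) v') :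
    IsWeakDeriv D n ((u + u' : Lp 𝕜 p (volume.restrict (Ω : Set E))) : E → 𝕜)
      (v + v' : Lp 𝕜 p (volume.restrict (Ω : Set E))) := by
  have key : ∀ (a b : Lp 𝕜 p (volume.restrict (Ω : Set E))) (φ : 𝓓(Ω, ℝ)),
      ∫ x in (Ω : Set E), φ x • (a + b : Lp 𝕜 p (volume.restrict (Ω : Set E))) x =
      (∫ x in (Ω : Set E), φ x • a x) + ∫ x in (Ω : Set E), φ x • b x := by
    intro a b φ
    rw [← integral_add (integrable_testFunction_smul a φ) (integrable_testFunction_smul b φ)]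
    refine integral_congr_ae ?_
    filter_upwards [Lp.coeFn_add a b] with x hx
    rw [hx, Pi.add_apply, smul_add]
  intro φ
  rw [key, key, h φ, h' φ, mul_add]

theorem IsWeakDeriv.const_smul {D : 𝓓(Ω, ℝ) → 𝓓(Ω, ℝ)} {n : ℕ}
    {u v : Lp 𝕜 p (volume.restrict (Ω : Set E))} (c : 𝕜)
    (h : IsWeakDeriv D n (u : E → 𝕜) v) :
    IsWeakDeriv D n ((c • u : Lp 𝕜 p (volume.restrict (Ω : Set E))) : E → 𝕜)
      (c • v : Lp 𝕜 p (volume.restrict (Ω : Set E))) := by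
  have key : ∀ (a : Lp 𝕜 p (volume.restrict (Ω : Set E))) (φ : 𝓓(Ω, ℝ)),
      ∫ x in (Ω : Set E), φ x • (c • a : Lp 𝕜 p (volume.restrict (Ω : Set E))) x =
      c * ∫ x in (Ω : Set E), φ x • a x := by
    intro a φ
    rw [← integral_const_mul]
    refine integral_congr_ae ?_
    filter_upwards [Lp.coeFn_smul c a] with x hx
    rw [hx, Pi.smul_apply, smul_eq_mul, mul_smul_comm]
  intro φ
  rw [key, key, h φ]
  ring

theorem isWeakDeriv_zero (D : 𝓓(Ω, ℝ) → 𝓓(Ω, ℝ)) (n : ℕ) :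
    IsWeakDeriv D n ((0 : Lp 𝕜 p (volume.restrict (Ω : Set E))) : E → 𝕜)
      (0 : Lp 𝕜 p (volume.restrict (Ω : Set E))) := by
  have key : ∀ φ : 𝓓(Ω, ℝ),
      ∫ x in (Ω : Set E), φ x • (0 : Lp 𝕜 p (volume.restrict (Ω : Set E))) x = 0 := by
    intro φ
    refine integral_eq_zero_of_ae ?_
    filter_upwards [Lp.coeFn_zero 𝕜 p (volume.restrict (Ω : Set E))] with x hx
    rw [hx, Pi.zero_apply, smul_zero]
  intro φ
  rw [key, key, mul_zero]

/-- Weak derivatives in `L^p` are unique. -/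
theorem IsWeakDeriv.unique [FiniteDimensional ℝ E] [BorelSpace E]
    [IsLocallyFiniteMeasure (volume : Measure E)]
    [Fact (1 ≤ p)] {D : 𝓓(Ω, ℝ) → 𝓓(Ω, ℝ)} {n : ℕ} {u : E → 𝕜}
    {v v' : Lp 𝕜 p (volume.restrict (Ω : Set E))}
    (h : IsWeakDeriv D n u v) (h' : IsWeakDeriv D n u v') : v = v' := by
  have hloc := ((Lp.memLp (v - v')).locallyIntegrable Fact.out).locallyIntegrableOn (Ω : Set E)
  have hz := Ω.isOpen.ae_eq_zero_of_integral_contDiff_smul_eq_zero hloc (by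
    intro g hg hgc hgs
    let φ : 𝓓(Ω, ℝ) := ⟨g, hg, hgc, hgs⟩
    have e : ∫ x in (Ω : Set E), φ x • v x = ∫ x in (Ω : Set E), φ x • v' x :=
      mul_left_cancel₀ (pow_ne_zero n (neg_ne_zero.mpr one_ne_zero)) ((h φ).symm.trans (h' φ))
    calc ∫ x in (Ω : Set E), g x • (v - v' : Lp 𝕜 p (volume.restrict (Ω : Set E))) x
        = ∫ x in (Ω : Set E), (φ x • v x - φ x • v' x) := by
          refine integral_congr_ae ?_
          filter_upwards [Lp.coeFn_sub v v'] with x hx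
          rw [hx, Pi.sub_apply, smul_sub]
          rfl
      _ = 0 := by
          rw [integral_sub (integrable_testFunction_smul v φ)
            (integrable_testFunction_smul v' φ), e, sub_self])
  rw [← sub_eq_zero]
  refine Lp.ext ?_
  filter_upwards [hz, ae_restrict_mem Ω.isOpen.measurableSet,
    Lp.coeFn_zero 𝕜 p (volume.restrict (Ω : Set E))] with x hx hxΩ h0
  rw [hx hxΩ, h0, Pi.zero_apply]

end WeakDerivative

/-- The set of `u ∈ L^p(Ω)`, `Ω ⊆ ℝ^d` open, whose weak derivatives `D^α u` exist and lie in
`L^p(Ω)` for all `|α| ≤ m`, as a linear subspace of `L^p(Ω)`. -/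
def sobolevSubmodule (𝕜 : Type*) [RCLike 𝕜] {d : ℕ} (Ω : Opens (Fin d → ℝ)) (m : ℕ) (p : ℝ≥0∞)
    [Fact (1 ≤ p)] : Submodule 𝕜 (Lp 𝕜 p (volume.restrict (Ω : Set (Fin d → ℝ)))) where
  carrier := {u | ∀ α : Fin d → ℕ, ∑ k, α k ≤ m →
    ∃ v : Lp 𝕜 p (volume.restrict (Ω : Set (Fin d → ℝ))),
      IsWeakDeriv (multiDeriv (Ω := Ω) α) (∑ k, α k) (u : (Fin d → ℝ) → 𝕜) v}
  add_mem' hu hu' α hα :=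
    ⟨(hu α hα).choose + (hu' α hα).choose, (hu α hα).choose_spec.add (hu' α hα).choose_spec⟩
  zero_mem' _ _ := ⟨0, isWeakDeriv_zero _ _⟩
  smul_mem' c _ hu α hα := ⟨c • (hu α hα).choose, (hu α hα).choose_spec.const_smul c⟩

/-- The Sobolev space `H^{m,p}(Ω)`. It is a type of its own, because its norm (defined below) is
not the one induced by `L^p(Ω)`. -/
def SobolevSpace (𝕜 : Type*) [RCLike 𝕜] {d : ℕ} (Ω : Opens (Fin d → ℝ)) (m : ℕ) (p : ℝ≥0∞)
    [Fact (1 ≤ p)] : Type _ :=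
  sobolevSubmodule 𝕜 Ω m p

namespace SobolevSpace

variable {𝕜 : Type*} [RCLike 𝕜] {d : ℕ} {Ω : Opens (Fin d → ℝ)} {m : ℕ} {p : ℝ≥0∞}
  [Fact (1 ≤ p)]

instance : AddCommGroup (SobolevSpace 𝕜 Ω m p) :=
  inferInstanceAs (AddCommGroup (sobolevSubmodule 𝕜 Ω m p))

instance : Module 𝕜 (SobolevSpace 𝕜 Ω m p) :=
  inferInstanceAs (Module 𝕜 (sobolevSubmodule 𝕜 Ω m p))

/-- The inclusion `H^{m,p}(Ω) → L^p(Ω)`. -/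
def toLp : SobolevSpace 𝕜 Ω m p →ₗ[𝕜] Lp 𝕜 p (volume.restrict (Ω : Set (Fin d → ℝ))) :=
  (sobolevSubmodule 𝕜 Ω m p).subtype

theorem toLp_injective : Function.Injective (toLp (𝕜 := 𝕜) (Ω := Ω) (m := m) (p := p)) :=
  Subtype.val_injective

/-- The weak derivative `D^α u ∈ L^p(Ω)` of `u ∈ H^{m,p}(Ω)`, for `|α| ≤ m`. -/
def weakDeriv (u : SobolevSpace 𝕜 Ω m p) (α : multiIndices d m) :
    Lp 𝕜 p (volume.restrict (Ω : Set (Fin d → ℝ))) :=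
  (u.2 α.1 (mem_multiIndices.mp α.2)).choose

theorem isWeakDeriv_weakDeriv (u : SobolevSpace 𝕜 Ω m p) (α : multiIndices d m) :
    IsWeakDeriv (multiDeriv (Ω := Ω) α.1) (∑ k, α.1 k) (toLp u : (Fin d → ℝ) → 𝕜)
      (u.weakDeriv α) :=
  (u.2 α.1 (mem_multiIndices.mp α.2)).choose_spec

/-- All weak derivatives of order at most `m` together, as an element of the `ℓ^1`-sum of copies of
`L^p(Ω)`. -/
def jet : SobolevSpace 𝕜 Ω m p →ₗ[𝕜]
    PiLp 1 (fun _ : multiIndices d m => Lp 𝕜 p (volume.restrict (Ω : Set (Fin d → ℝ)))) where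
  toFun u := WithLp.toLp 1 u.weakDeriv
  map_add' u v := by
    ext1 α
    exact (isWeakDeriv_weakDeriv (u + v) α).unique
      ((isWeakDeriv_weakDeriv u α).add (isWeakDeriv_weakDeriv v α))
  map_smul' c u := by
    ext1 α
    exact (isWeakDeriv_weakDeriv (c • u) α).unique ((isWeakDeriv_weakDeriv u α).const_smul c)

theorem multiDeriv_zero (φ : 𝓓(Ω, ℝ)) : multiDeriv (0 : Fin d → ℕ) φ = φ := by
  unfold multiDeriv
  induction List.finRange d with
  | nil => rfl
  | cons k l _ => simp

theorem weakDeriv_zero (u : SobolevSpace 𝕜 Ω m p) :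
    u.weakDeriv ⟨0, mem_multiIndices.mpr (by simp)⟩ = toLp u := by
  refine (isWeakDeriv_weakDeriv u ⟨0, mem_multiIndices.mpr (by simp)⟩).unique ?_
  intro φ
  simp [multiDeriv_zero]

theorem jet_injective : Function.Injective (jet (𝕜 := 𝕜) (Ω := Ω) (m := m) (p := p)) := by
  intro u v h
  apply toLp_injective
  rw [← weakDeriv_zero, ← weakDeriv_zero]
  exact congrFun (congrArg WithLp.ofLp h) ⟨0, mem_multiIndices.mpr (by simp)⟩

/-- `H^{m,p}(Ω)` with the norm `‖u‖_{m,p} = ∑_{|α| ≤ m} ‖D^α u‖_{L^p(Ω)}`. -/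
instance : NormedAddCommGroup (SobolevSpace 𝕜 Ω m p) :=
  NormedAddCommGroup.induced _ _ (jet (𝕜 := 𝕜) (Ω := Ω) (m := m) (p := p)) jet_injective

instance : NormedSpace 𝕜 (SobolevSpace 𝕜 Ω m p) :=
  NormedSpace.induced 𝕜 _ _ (jet (𝕜 := 𝕜) (Ω := Ω) (m := m) (p := p))

theorem norm_eq_sum (u : SobolevSpace 𝕜 Ω m p) : ‖u‖ = ∑ α, ‖u.weakDeriv α‖ := by
  change ‖jet u‖ = _
  rw [PiLp.norm_eq_of_nat 1 (by simp)]
  simp [jet]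

end SobolevSpace

/-- The subset `H^{m,p}(Ω)` of `L^p(Ω)` for an open set `Ω ⊆ ℝ`: the functions whose weak
derivatives of order `j ≤ m` exist and lie in `L^p(Ω)`. -/
def sobolevOnLine (𝕜 : Type*) [RCLike 𝕜] (Ω : Opens ℝ) (m : ℕ) (p : ℝ≥0∞) :
    Set (Lp 𝕜 p (volume.restrict (Ω : Set ℝ))) :=
  {w | ∀ j ≤ m, ∃ v : Lp 𝕜 p (volume.restrict (Ω : Set ℝ)),
    IsWeakDeriv (fun φ : 𝓓(Ω, ℝ) => (fun η : 𝓓(Ω, ℝ) => ∂_{(1 : ℝ)} η)^[j] φ) j (w : ℝ → 𝕜) v}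

/-- The open set `Ω_1 × ⋯ × Ω_d ⊆ ℝ^d`. -/
def productOpens {d : ℕ} (Ω : Fin d → Opens ℝ) : Opens (Fin d → ℝ) :=
  ⟨Set.univ.pi fun k => (Ω k : Set ℝ), isOpen_set_pi Set.finite_univ fun k _ => (Ω k).isOpen⟩

/-- `IsTensor u w` says that `u = w_1 ⊗ ⋯ ⊗ w_d`, i.e. `u(x) = w_1(x_1) ⋯ w_d(x_d)` for almost
every `x ∈ Ω_1 × ⋯ × Ω_d`. -/
def IsTensor {𝕜 : Type*} [RCLike 𝕜] {d : ℕ} {Ω : Fin d → Opens ℝ} {m : ℕ} {p : ℝ≥0∞}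
    [Fact (1 ≤ p)] (u : SobolevSpace 𝕜 (productOpens Ω) m p)
    (w : ∀ k, Lp 𝕜 p (volume.restrict (Ω k : Set ℝ))) : Prop :=
  (u.toLp : (Fin d → ℝ) → 𝕜) =ᵐ[volume.restrict (productOpens Ω : Set (Fin d → ℝ))]
    fun x => ∏ k, w k (x k)

/-- The rank-one tensors `⊗_k w^{(k)}` with `w^{(k)} ∈ H^{m,p}(Ω_k)`, as a subset of
`H^{m,p}(Ω_1 × ⋯ × Ω_d)`. -/
def rankOneTensors (𝕜 : Type*) [RCLike 𝕜] {d : ℕ} (Ω : Fin d → Opens ℝ) (m : ℕ) (p : ℝ≥0∞)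
    [Fact (1 ≤ p)] : Set (SobolevSpace 𝕜 (productOpens Ω) m p) :=
  {u | ∃ w : ∀ k, Lp 𝕜 p (volume.restrict (Ω k : Set ℝ)),
    (∀ k, w k ∈ sobolevOnLine 𝕜 (Ω k) m p) ∧ IsTensor u w}

end

/-! ### Product test functions, their slices and their derivatives -/

section ProductTestFunctions

variable {d : ℕ} {Ω : Fin d → Opens ℝ}

/-! Rank one is a system of quadratic equations in weakly continuous functionals. For test functions
`f k` put `l f = ∫ (f_1 ⊗ ⋯ ⊗ f_d) u`. If `u` is a tensor, `l` is a product of one-variable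
integrals, so exchanging the `k`-th entries of `f` and `g` does not change `l f * l g`. These
identities are the vanishing of 2×2 minors; each defines a weakly closed set, and so does their
intersection.

Conversely (`mem_rankOneTensors_iff_minors`), suppose `d ≥ 1`, the identities hold and `l g ≠ 0`.
Exchanging one slot at a time (`piecewise_mul_pow_card_eq_prod`) expresses `l f` through the numbers
`l (Function.update g k (f k))`. As a functional of `f k`, each of these is integration against the
marginal of `u` weighted by the other `g j`. By Hölder the marginal lies in `L^p`
(`exists_marginal`), and its weak derivatives are marginals of those of `u`
(`marginal_mem_sobolevOnLine`). The rescaled tensor of the marginals agrees with `u` on all product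
test functions, and these separate `L^p` (`ae_eq_of_forall_integral_tensorTest_eq`). If `l` vanishes
identically, then `u = 0`.

That tensors of Sobolev functions are Sobolev follows from Fubini, one variable at a time. -/

theorem mem_productOpens {x : Fin d → ℝ} :
    x ∈ (productOpens Ω : Set (Fin d → ℝ)) ↔ ∀ k, x k ∈ (Ω k : Set ℝ) := by
  simp [productOpens]

theorem prod_update_apply {R : Type*} [CommMonoid R] {F : Fin d → Type*}
    (c : ∀ k, F k → R) (φ : ∀ k, F k) (k : Fin d) (ψ : F k) :
    ∏ j, c j (Function.update φ k ψ j) = c k ψ * ∏ j ∈ Finset.univ.erase k, c j (φ j) := by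
  rw [← Finset.mul_prod_erase _ _ (Finset.mem_univ k), Function.update_self]
  congr 1
  refine Finset.prod_congr rfl fun j hj => ?_
  rw [Function.update_of_ne (Finset.ne_of_mem_erase hj)]

/-- The test function `x ↦ φ_1(x_1) ⋯ φ_d(x_d)` on a product of open sets. -/
noncomputable def tensorTest (φ : ∀ k, 𝓓(Ω k, ℝ)) : 𝓓(productOpens Ω, ℝ) :=
  have hsub : (Function.support fun x : Fin d → ℝ => ∏ k, φ k (x k)) ⊆
      Set.univ.pi fun k => tsupport (φ k) := fun _ hx k _ =>
    subset_tsupport _ fun h => hx (Finset.prod_eq_zero (Finset.mem_univ k) h)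
  have hc : IsCompact (Set.univ.pi fun k => tsupport (φ k)) :=
    isCompact_univ_pi fun k => (φ k).hasCompactSupport
  { toFun := fun x => ∏ k, φ k (x k)
    contDiff' := contDiff_prod fun k _ => (φ k).contDiff.comp (contDiff_apply ℝ ℝ k)
    hasCompactSupport' := HasCompactSupport.of_support_subset_isCompact hc hsub
    tsupport_subset' := (closure_minimal hsub hc.isClosed).trans fun _ hx =>
      mem_productOpens.mpr fun k => (φ k).tsupport_subset (hx k trivial) }

theorem tensorTest_apply (φ : ∀ k, 𝓓(Ω k, ℝ)) (x : Fin d → ℝ) :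
    tensorTest φ x = ∏ k, φ k (x k) := rfl

/-- The restriction of a test function on a product of open sets to a line parallel to the `k`-th
coordinate axis. -/
noncomputable def sliceTest (φ : 𝓓(productOpens Ω, ℝ)) (k : Fin d) (y : Fin d → ℝ) : 𝓓(Ω k, ℝ) :=
  have hK : IsCompact ((fun x : Fin d → ℝ => x k) '' tsupport φ) :=
    φ.hasCompactSupport.isCompact.image (continuous_apply k)
  have hsub : (Function.support fun t : ℝ => φ (Function.update y k t)) ⊆
      (fun x : Fin d → ℝ => x k) '' tsupport φ := fun t ht =>
    ⟨Function.update y k t, subset_tsupport _ ht, Function.update_self ..⟩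
  { toFun := fun t => φ (Function.update y k t)
    contDiff' := φ.contDiff.comp (contDiff_update _ y k)
    hasCompactSupport' := HasCompactSupport.of_support_subset_isCompact hK hsub
    tsupport_subset' := (closure_minimal hsub hK.isClosed).trans <| by
      rintro _ ⟨x, hx, rfl⟩
      exact mem_productOpens.mp (φ.tsupport_subset hx) k }

theorem sliceTest_apply (φ : 𝓓(productOpens Ω, ℝ)) (k : Fin d) (y : Fin d → ℝ) (t : ℝ) :
    sliceTest φ k y t = φ (Function.update y k t) := rfl

theorem TestFunction.lineDerivOp_apply {E : Type*} [NormedAddCommGroup E] [NormedSpace ℝ E]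
    {U : Opens E} (φ : 𝓓(U, ℝ)) (v x : E) : (∂_{v} φ : 𝓓(U, ℝ)) x = lineDeriv ℝ φ x v := by
  rw [TestFunction.lineDerivOp_eq_lineDerivCLM ℝ, TestFunction.lineDerivCLM_apply]
  simp

/-- Along the `k`-th axis all factors but the `k`-th are constant. -/
theorem tensorTest_lineDeriv (φ : ∀ k, 𝓓(Ω k, ℝ)) (k : Fin d) :
    ∂_{(Pi.single k 1 : Fin d → ℝ)} (tensorTest φ) =
      tensorTest (Function.update φ k (∂_{(1 : ℝ)} (φ k))) := by
  ext x
  rw [TestFunction.lineDerivOp_apply, tensorTest_apply,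
    prod_update_apply (fun j (f : 𝓓(Ω j, ℝ)) => f (x j)), TestFunction.lineDerivOp_apply, lineDeriv,
    lineDeriv, ← deriv_mul_const_field]
  congr 1
  funext t
  rw [tensorTest_apply, ← Finset.mul_prod_erase _ _ (Finset.mem_univ k)]
  congr 1
  · simp
  · refine Finset.prod_congr rfl fun j hj => ?_
    simp [Finset.ne_of_mem_erase hj]

theorem tensorTest_lineDeriv_iterate (φ : ∀ k, 𝓓(Ω k, ℝ)) (k : Fin d) (n : ℕ) :
    (fun η : 𝓓(productOpens Ω, ℝ) => ∂_{(Pi.single k 1 : Fin d → ℝ)} η)^[n] (tensorTest φ) =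
      tensorTest (Function.update φ k ((fun η : 𝓓(Ω k, ℝ) => ∂_{(1 : ℝ)} η)^[n] (φ k))) := by
  induction n with
  | zero => simp
  | succ n ih =>
    rw [Function.iterate_succ_apply', ih, tensorTest_lineDeriv, Function.update_idem,
      Function.update_self, Function.iterate_succ_apply']

theorem sliceTest_lineDeriv (φ : 𝓓(productOpens Ω, ℝ)) (k : Fin d) (y : Fin d → ℝ) :
    sliceTest (∂_{(Pi.single k 1 : Fin d → ℝ)} φ) k y = ∂_{(1 : ℝ)} (sliceTest φ k y) := by
  ext t
  rw [sliceTest_apply, TestFunction.lineDerivOp_apply, TestFunction.lineDerivOp_apply, lineDeriv,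
    lineDeriv]
  congr 1
  funext s
  rw [sliceTest_apply]
  congr 1
  ext j
  rcases eq_or_ne j k with rfl | hj
  · simp
  · simp [hj]

theorem sliceTest_lineDeriv_iterate (φ : 𝓓(productOpens Ω, ℝ)) (k : Fin d) (y : Fin d → ℝ)
    (n : ℕ) :
    sliceTest ((fun η : 𝓓(productOpens Ω, ℝ) => ∂_{(Pi.single k 1 : Fin d → ℝ)} η)^[n] φ) k y =
      (fun η : 𝓓(Ω k, ℝ) => ∂_{(1 : ℝ)} η)^[n] (sliceTest φ k y) := by
  induction n with
  | zero => rfl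
  | succ n ih =>
    rw [Function.iterate_succ_apply', Function.iterate_succ_apply', sliceTest_lineDeriv, ih]

theorem multiDeriv_single {U : Opens (Fin d → ℝ)} (k : Fin d) (n : ℕ) (φ : 𝓓(U, ℝ)) :
    multiDeriv (Pi.single k n) φ =
      (fun η : 𝓓(U, ℝ) => ∂_{(Pi.single k 1 : Fin d → ℝ)} η)^[n] φ := by
  -- Only the entry `k` of the list contributes a derivative, and it occurs at most once.
  have key : ∀ l : List (Fin d), l.Nodup →
      l.foldr (fun j ψ => (fun η : 𝓓(U, ℝ) =>
        ∂_{(Pi.single j 1 : Fin d → ℝ)} η)^[(Pi.single k n : Fin d → ℕ) j] ψ) φ =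
      if k ∈ l then (fun η : 𝓓(U, ℝ) => ∂_{(Pi.single k 1 : Fin d → ℝ)} η)^[n] φ else φ := by
    intro l
    induction l with
    | nil => simp
    | cons j l ih =>
      intro hl
      rw [List.nodup_cons] at hl
      rw [List.foldr_cons, ih hl.2]
      rcases eq_or_ne j k with rfl | hj
      · simp [hl.1]
      · simp [hj, hj.symm]
  rw [multiDeriv, key _ (List.nodup_finRange d), if_pos (List.mem_finRange k)]

end ProductTestFunctions

/-! ### Products of functions and Fubini on finite product measures -/

section PiMeasure

theorem memLp_prod_pi {ι : Type*} [Fintype ι] {E : ι → Type*} {mE : ∀ i, MeasurableSpace (E i)}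
    {μ : ∀ i, Measure (E i)} [∀ i, SigmaFinite (μ i)] {𝕜 : Type*} [RCLike 𝕜] {p : ℝ≥0∞}
    (hp0 : p ≠ 0) (hp : p ≠ ∞) {f : ∀ i, E i → 𝕜} (hf : ∀ i, MemLp (f i) p (μ i)) :
    MemLp (fun x : ∀ i, E i => ∏ i, f i (x i)) p (Measure.pi μ) := by
  have hm : AEStronglyMeasurable (fun x : ∀ i, E i => ∏ i, f i (x i)) (Measure.pi μ) :=
    Finset.aestronglyMeasurable_fun_prod _ fun i _ =>
      (hf i).1.comp_quasiMeasurePreserving (Measure.quasiMeasurePreserving_eval μ i)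
  rw [← integrable_norm_rpow_iff hm hp0 hp]
  have h : Integrable (fun x : ∀ i, E i => ∏ i, ‖f i (x i)‖ ^ p.toReal) (Measure.pi μ) :=
    Integrable.fintype_prod_dep (f := fun i (t : E i) => ‖f i t‖ ^ p.toReal)
      fun i => (hf i).integrable_norm_rpow hp0 hp
  refine h.congr (Filter.Eventually.of_forall fun x => ?_)
  simp only [norm_prod]
  exact Real.finsetProd_rpow _ _ (fun _ _ => norm_nonneg _) _

variable {n : ℕ} (μ : Fin (n + 1) → Measure ℝ) [∀ i, SigmaFinite (μ i)] (k : Fin (n + 1))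

theorem measurePreserving_insertNth :
    MeasurePreserving (fun z : ℝ × (Fin n → ℝ) => (k.insertNth z.1 z.2 : Fin (n + 1) → ℝ))
      ((μ k).prod (Measure.pi fun j => μ (k.succAbove j))) (Measure.pi μ) :=
  (measurePreserving_piFinSuccAbove μ k).symm

theorem integral_pi_eq_integral_insertNth {F : Type*} [NormedAddCommGroup F] [NormedSpace ℝ F]
    (f : (Fin (n + 1) → ℝ) → F) :
    ∫ x, f x ∂Measure.pi μ =
      ∫ z, f (k.insertNth z.1 z.2) ∂(μ k).prod (Measure.pi fun j => μ (k.succAbove j)) :=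
  ((measurePreserving_piFinSuccAbove μ k).symm.integral_comp' f).symm

end PiMeasure

/-! ### Tensors of Sobolev functions are Sobolev -/

section TensorProducts

variable {𝕜 : Type*} [RCLike 𝕜] {d : ℕ} {Ω : Fin d → Opens ℝ} {p : ℝ≥0∞}

theorem restrict_productOpens (Ω : Fin d → Opens ℝ) :
    (volume.restrict (productOpens Ω : Set (Fin d → ℝ))) =
      Measure.pi fun k => volume.restrict (Ω k : Set ℝ) := by
  rw [volume_pi]
  exact Measure.restrict_pi_pi _ _

theorem MeasureTheory.MemLp.integrable_testFunction_smul {E : Type*} [NormedAddCommGroup E]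
    [NormedSpace ℝ E] [MeasureSpace E] [BorelSpace E] [IsLocallyFiniteMeasure (volume : Measure E)]
    {U : Opens E} {u : E → 𝕜} [Fact (1 ≤ p)] (hu : MemLp u p (volume.restrict (U : Set E)))
    (φ : 𝓓(U, ℝ)) : Integrable (fun x => φ x • u x) (volume.restrict (U : Set E)) :=
  (hu.locallyIntegrable Fact.out).integrable_smul_left_of_hasCompactSupport
    φ.continuous φ.hasCompactSupport

theorem memLp_tensor (hp0 : p ≠ 0) (hp : p ≠ ∞)
    (w : ∀ k, Lp 𝕜 p (volume.restrict (Ω k : Set ℝ))) :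
    MemLp (fun x : Fin d → ℝ => ∏ k, w k (x k)) p
      (volume.restrict (productOpens Ω : Set (Fin d → ℝ))) := by
  rw [restrict_productOpens]
  exact memLp_prod_pi hp0 hp fun k => Lp.memLp (w k)

/-- By Fubini, integrate first along lines parallel to the `k`-th axis. There the test function is a
one-variable test function, so the weak derivative of `w k` applies, while the other factors are
constants. -/
theorem integral_lineDeriv_iterate_smul_tensor [Fact (1 ≤ p)] (hp : p ≠ ∞)
    (w : ∀ k, Lp 𝕜 p (volume.restrict (Ω k : Set ℝ))) (k : Fin d) (n : ℕ)
    {v : Lp 𝕜 p (volume.restrict (Ω k : Set ℝ))}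
    (h : IsWeakDeriv (fun φ : 𝓓(Ω k, ℝ) => (fun η : 𝓓(Ω k, ℝ) => ∂_{(1 : ℝ)} η)^[n] φ) n
      (w k : ℝ → 𝕜) v) (φ : 𝓓(productOpens Ω, ℝ)) :
    ∫ x in (productOpens Ω : Set (Fin d → ℝ)),
        ((fun η : 𝓓(productOpens Ω, ℝ) => ∂_{(Pi.single k 1 : Fin d → ℝ)} η)^[n] φ) x •
          ∏ j, w j (x j) =
      (-1) ^ n * ∫ x in (productOpens Ω : Set (Fin d → ℝ)),
        φ x • ∏ j, Function.update w k v j (x j) := by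
  have hp0 : p ≠ 0 := (zero_lt_one.trans_le (Fact.out : 1 ≤ p)).ne'
  cases d with
  | zero => exact k.elim0
  | succ d =>
    set ψ := (fun η : 𝓓(productOpens Ω, ℝ) => ∂_{(Pi.single k 1 : Fin (d + 1) → ℝ)} η)^[n] φ
      with hψ
    have hi : ∀ (θ : 𝓓(productOpens Ω, ℝ)) (w : ∀ k, Lp 𝕜 p (volume.restrict (Ω k : Set ℝ))),
        Integrable (fun z : ℝ × (Fin d → ℝ) => θ (k.insertNth z.1 z.2) •
          ∏ j, w j ((k.insertNth z.1 z.2 : Fin (d + 1) → ℝ) j))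
          ((volume.restrict (Ω k : Set ℝ)).prod
            (Measure.pi fun j => volume.restrict (Ω (k.succAbove j) : Set ℝ))) := by
      intro θ w
      have h := (memLp_tensor hp0 hp w).integrable_testFunction_smul θ
      rw [restrict_productOpens] at h
      exact (measurePreserving_insertNth _ k).integrable_comp_of_integrable h
    rw [restrict_productOpens, integral_pi_eq_integral_insertNth _ k,
      integral_pi_eq_integral_insertNth _ k, integral_prod_symm _ (hi ψ w),
      integral_prod_symm _ (hi φ _), ← integral_const_mul]
    congr 1
    funext y
    -- The inserted `0` is arbitrary: `sliceTest` overwrites the `k`-th coordinate.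
    have hs : ∀ (θ : 𝓓(productOpens Ω, ℝ)) (w : ∀ k, Lp 𝕜 p (volume.restrict (Ω k : Set ℝ))),
        ∫ t in (Ω k : Set ℝ), θ (k.insertNth t y) •
          ∏ j, w j ((k.insertNth t y : Fin (d + 1) → ℝ) j) =
        (∫ t in (Ω k : Set ℝ), sliceTest θ k (k.insertNth 0 y) t • w k t) *
          ∏ i, w (k.succAbove i) (y i) := by
      intro θ w
      rw [← integral_mul_const]
      congr 1
      funext t
      rw [sliceTest_apply, Fin.update_insertNth, Fin.prod_univ_succAbove _ k, smul_mul_assoc]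
      simp
    rw [hs, hs, hψ, sliceTest_lineDeriv_iterate, h, Function.update_self, mul_assoc]
    congr 2
    refine Finset.prod_congr rfl fun i _ => ?_
    rw [Function.update_of_ne (Fin.succAbove_ne k i)]

theorem isWeakDeriv_tensor [Fact (1 ≤ p)] (hp : p ≠ ∞)
    (w : ∀ k, Lp 𝕜 p (volume.restrict (Ω k : Set ℝ))) (α : Fin d → ℕ)
    {v : ∀ k, Lp 𝕜 p (volume.restrict (Ω k : Set ℝ))}
    (h : ∀ k, IsWeakDeriv (fun φ : 𝓓(Ω k, ℝ) => (fun η : 𝓓(Ω k, ℝ) => ∂_{(1 : ℝ)} η)^[α k] φ)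
      (α k) (w k : ℝ → 𝕜) (v k)) :
    IsWeakDeriv (multiDeriv (Ω := productOpens Ω) α) (∑ k, α k)
      (fun x : Fin d → ℝ => ∏ k, w k (x k)) (fun x => ∏ k, v k (x k)) := by
  -- The family `w'` varies in the induction: coordinates already treated carry `v`, and only those
  -- still in `l` must agree with `w`.
  have key : ∀ l : List (Fin d), l.Nodup → ∀ φ : 𝓓(productOpens Ω, ℝ),
      ∀ w' : ∀ k, Lp 𝕜 p (volume.restrict (Ω k : Set ℝ)), (∀ k ∈ l, w' k = w k) →
      ∫ x in (productOpens Ω : Set (Fin d → ℝ)),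
        (l.foldr (fun k ψ => (fun η : 𝓓(productOpens Ω, ℝ) =>
          ∂_{(Pi.single k 1 : Fin d → ℝ)} η)^[α k] ψ) φ) x • ∏ j, w' j (x j) =
      (-1) ^ (l.map α).sum * ∫ x in (productOpens Ω : Set (Fin d → ℝ)),
        φ x • ∏ j, (if j ∈ l then v j else w' j) (x j) := by
    intro l
    induction l with
    | nil => simp
    | cons k l ih =>
      intro hl φ w' hw'
      rw [List.nodup_cons] at hl
      have hk : IsWeakDeriv (fun φ : 𝓓(Ω k, ℝ) =>
          (fun η : 𝓓(Ω k, ℝ) => ∂_{(1 : ℝ)} η)^[α k] φ) (α k) (w' k : ℝ → 𝕜) (v k) := by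
        rw [hw' k List.mem_cons_self]
        exact h k
      rw [List.foldr_cons, integral_lineDeriv_iterate_smul_tensor hp w' k (α k) hk,
        ih hl.2 φ, List.map_cons, List.sum_cons, pow_add, mul_assoc]
      · congr 4
        funext x
        congr 1
        refine Finset.prod_congr rfl fun j _ => ?_
        rcases eq_or_ne j k with rfl | hj
        · simp [hl.1]
        · simp [hj]
      · intro j hj
        rw [Function.update_of_ne (ne_of_mem_of_not_mem hj hl.1), hw' j (List.mem_cons_of_mem _ hj)]
  intro φ
  have := key _ (List.nodup_finRange d) φ w fun _ _ => rfl
  simpa [multiDeriv, ← List.ofFn_eq_map, List.sum_ofFn] using this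

theorem IsWeakDeriv.congr_ae {E : Type*} [NormedAddCommGroup E] [NormedSpace ℝ E]
    [MeasureSpace E] {U : Opens E} {D : 𝓓(U, ℝ) → 𝓓(U, ℝ)} {n : ℕ} {u u' v v' : E → 𝕜}
    (h : IsWeakDeriv D n u v) (hu : u =ᵐ[volume.restrict (U : Set E)] u')
    (hv : v =ᵐ[volume.restrict (U : Set E)] v') : IsWeakDeriv D n u' v' := by
  intro φ
  rw [← integral_congr_ae (hu.mono fun x hx => congrArg (D φ x • ·) hx), h φ,
    integral_congr_ae (hv.mono fun x hx => congrArg (φ x • ·) hx)]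

theorem exists_isTensor [Fact (1 ≤ p)] (hp : p ≠ ∞) {m : ℕ}
    (w : ∀ k, Lp 𝕜 p (volume.restrict (Ω k : Set ℝ)))
    (hw : ∀ k, w k ∈ sobolevOnLine 𝕜 (Ω k) m p) :
    ∃ u : SobolevSpace 𝕜 (productOpens Ω) m p, IsTensor u w := by
  have hp0 : p ≠ 0 := (zero_lt_one.trans_le (Fact.out : 1 ≤ p)).ne'
  refine ⟨⟨(memLp_tensor hp0 hp w).toLp _, fun α hα => ?_⟩, (memLp_tensor hp0 hp w).coeFn_toLp⟩
  choose v hv using fun k => hw k (α k)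
    ((Finset.single_le_sum (fun _ _ => Nat.zero_le _) (Finset.mem_univ k)).trans hα)
  exact ⟨(memLp_tensor hp0 hp v).toLp _, (isWeakDeriv_tensor hp w α hv).congr_ae
    (memLp_tensor hp0 hp w).coeFn_toLp.symm (memLp_tensor hp0 hp v).coeFn_toLp.symm⟩

end TensorProducts

/-! ### Weighted marginals and their weak derivatives -/

section Marginals

/-- Hölder in `y` for almost every fixed `t` bounds the `r`-th power of the integral by a constant
times `∫ |F(t, y)|^r dy`; Tonelli then integrates this bound in `t`. -/
theorem MeasureTheory.MemLp.integral_mul_prod_right {α β 𝕜 : Type*} [MeasurableSpace α]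
    [MeasurableSpace β] [RCLike 𝕜] {μ : Measure α} {ν : Measure β} [SFinite μ] [SFinite ν]
    {r s : ℝ} (hrs : r.HolderConjugate s) {F : α × β → 𝕜} {g : β → 𝕜}
    (hF : MemLp F (ENNReal.ofReal r) (μ.prod ν)) (hg : MemLp g (ENNReal.ofReal s) ν) :
    MemLp (fun t => ∫ y, g y * F (t, y) ∂ν) (ENNReal.ofReal r) μ := by
  have hr0 : ENNReal.ofReal r ≠ 0 := by simpa using hrs.pos
  have hs0 : ENNReal.ofReal s ≠ 0 := by simpa using hrs.symm.pos
  have hrr : (ENNReal.ofReal r).toReal = r := ENNReal.toReal_ofReal hrs.nonneg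
  have hss : (ENNReal.ofReal s).toReal = s := ENNReal.toReal_ofReal hrs.symm.nonneg
  have hF' := lintegral_rpow_enorm_lt_top_of_eLpNorm_lt_top hr0 ENNReal.ofReal_ne_top hF.2
  have hg' := lintegral_rpow_enorm_lt_top_of_eLpNorm_lt_top hs0 ENNReal.ofReal_ne_top hg.2
  rw [hrr] at hF'
  rw [hss] at hg'
  refine ⟨(hg.1.comp_snd.mul hF.1).integral_prod_right', ?_⟩
  rw [eLpNorm_lt_top_iff_lintegral_rpow_enorm_lt_top hr0 ENNReal.ofReal_ne_top, hrr]
  set G := (∫⁻ y, ‖g y‖ₑ ^ s ∂ν) ^ (1 / s) with hG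
  have hGtop : G ^ r ≠ ∞ := ENNReal.rpow_ne_top_of_nonneg hrs.nonneg
    (ENNReal.rpow_ne_top_of_nonneg (one_div_nonneg.mpr hrs.symm.nonneg) hg'.ne)
  have hle : ∀ᵐ t ∂μ, ‖∫ y, g y * F (t, y) ∂ν‖ₑ ^ r ≤ G ^ r * ∫⁻ y, ‖F (t, y)‖ₑ ^ r ∂ν := by
    filter_upwards [hF.1.prodMk_left] with t ht
    calc ‖∫ y, g y * F (t, y) ∂ν‖ₑ ^ r
        ≤ (∫⁻ y, ‖g y‖ₑ * ‖F (t, y)‖ₑ ∂ν) ^ r := by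
          refine ENNReal.rpow_le_rpow ((enorm_integral_le_lintegral_enorm _).trans_eq ?_)
            hrs.nonneg
          simp [enorm_mul]
      _ ≤ (G * (∫⁻ y, ‖F (t, y)‖ₑ ^ r ∂ν) ^ (1 / r)) ^ r :=
          ENNReal.rpow_le_rpow (ENNReal.lintegral_mul_le_Lp_mul_Lq ν hrs.symm hg.1.enorm
            ht.enorm) hrs.nonneg
      _ = G ^ r * ∫⁻ y, ‖F (t, y)‖ₑ ^ r ∂ν := by
          rw [ENNReal.mul_rpow_of_nonneg _ _ hrs.nonneg, ← ENNReal.rpow_mul _ (1 / r),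
            one_div_mul_cancel hrs.ne_zero, ENNReal.rpow_one]
  refine (lintegral_mono_ae hle).trans_lt ?_
  rw [lintegral_const_mul' _ _ hGtop,
    ← lintegral_prod (fun z => ‖F z‖ₑ ^ r) (hF.1.enorm.pow_const r)]
  exact ENNReal.mul_lt_top hGtop.lt_top hF'

variable {𝕜 : Type*} [RCLike 𝕜] {d : ℕ} {Ω : Fin d → Opens ℝ} {p : ℝ≥0∞}

theorem TestFunction.memLp_ofReal {E : Type*} [NormedAddCommGroup E] [NormedSpace ℝ E]
    [MeasurableSpace E] [BorelSpace E] {U : Opens E} (φ : 𝓓(U, ℝ)) (q : ℝ≥0∞) (μ : Measure E)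
    [IsFiniteMeasureOnCompacts μ] : MemLp (fun x => (φ x : 𝕜)) q μ :=
  (φ.continuous.memLp_of_hasCompactSupport φ.hasCompactSupport).ofReal

/-- The witness integrates `u` against the product of the `η j` with `j ≠ k` over the remaining
variables; the entry `η k` plays no role. The integral identity is Fubini. -/
theorem exists_marginal [Fact (1 ≤ p)] (hp₁ : 1 < p) (hp : p < ∞)
    {u : (Fin d → ℝ) → 𝕜} (hu : MemLp u p (volume.restrict (productOpens Ω : Set (Fin d → ℝ))))
    (η : ∀ k, 𝓓(Ω k, ℝ)) (k : Fin d) : ∃ w : Lp 𝕜 p (volume.restrict (Ω k : Set ℝ)), ∀ φ : 𝓓(Ω k, ℝ),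
      ∫ t in (Ω k : Set ℝ), φ t • w t =
        ∫ x in (productOpens Ω : Set (Fin d → ℝ)), tensorTest (Function.update η k φ) x • u x := by
  cases d with
  | zero => exact k.elim0
  | succ d =>
    have hrs := Real.HolderConjugate.conjExponent
      ((ENNReal.toReal_lt_toReal ENNReal.one_ne_top hp.ne).mpr hp₁)
    have hpr : ENNReal.ofReal p.toReal = p := ENNReal.ofReal_toReal hp.ne
    have hmp := measurePreserving_insertNth (fun j => volume.restrict (Ω j : Set ℝ)) k
    have hg : MemLp (fun y : Fin d → ℝ => ∏ i, (η (k.succAbove i) (y i) : 𝕜))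
        (ENNReal.ofReal p.toReal.conjExponent)
        (Measure.pi fun j => volume.restrict (Ω (k.succAbove j) : Set ℝ)) :=
      memLp_prod_pi (by simpa using hrs.symm.pos) ENNReal.ofReal_ne_top
        (f := fun i (t : ℝ) => (η (k.succAbove i) t : 𝕜)) fun i => TestFunction.memLp_ofReal _ _ _
    have hF : MemLp (fun z : ℝ × (Fin d → ℝ) => u (k.insertNth z.1 z.2))
        (ENNReal.ofReal p.toReal) ((volume.restrict (Ω k : Set ℝ)).prod
          (Measure.pi fun j => volume.restrict (Ω (k.succAbove j) : Set ℝ))) := by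
      rw [hpr]
      exact (restrict_productOpens Ω ▸ hu).comp_measurePreserving hmp
    have hw := hF.integral_mul_prod_right hrs hg
    rw [hpr] at hw
    refine ⟨hw.toLp _, fun φ => ?_⟩
    have hi := hu.integrable_testFunction_smul (tensorTest (Function.update η k φ))
    rw [restrict_productOpens] at hi
    have hprod : ∀ (t : ℝ) (y : Fin d → ℝ),
        tensorTest (Function.update η k φ) (k.insertNth t y) • u (k.insertNth t y) =
        φ t • ((∏ i, (η (k.succAbove i) (y i) : 𝕜)) * u (k.insertNth t y)) := by
      intro t y
      rw [tensorTest_apply, Fin.prod_univ_succAbove _ k, RCLike.real_smul_eq_coe_mul,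
        RCLike.real_smul_eq_coe_mul]
      simp [mul_assoc, Fin.succAbove_ne]
    have hi' := hmp.integrable_comp_of_integrable hi
    rw [Function.comp_def] at hi'
    rw [integral_congr_ae (hw.coeFn_toLp.mono fun t ht => congrArg (φ t • ·) ht),
      restrict_productOpens, integral_pi_eq_integral_insertNth _ k, integral_prod _ hi']
    congr 1
    funext t
    rw [← integral_smul]
    exact integral_congr_ae (Filter.Eventually.of_forall fun y => (hprod t y).symm)

/-- The `j`-th weak derivative is the marginal of `∂_k^j u` with the same weights, since `∂_k^j` of
a product test function acts on its `k`-th factor only. -/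
theorem marginal_mem_sobolevOnLine [Fact (1 ≤ p)] (hp₁ : 1 < p) (hp : p < ∞) {m : ℕ}
    (u : SobolevSpace 𝕜 (productOpens Ω) m p) (η : ∀ k, 𝓓(Ω k, ℝ)) (k : Fin d)
    {w : Lp 𝕜 p (volume.restrict (Ω k : Set ℝ))}
    (hw : ∀ φ : 𝓓(Ω k, ℝ), ∫ t in (Ω k : Set ℝ), φ t • w t =
      ∫ x in (productOpens Ω : Set (Fin d → ℝ)),
        tensorTest (Function.update η k φ) x • u.toLp x) :
    w ∈ sobolevOnLine 𝕜 (Ω k) m p := by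
  intro j hj
  have hsum : ∑ i, (Pi.single k j : Fin d → ℕ) i = j := by simp
  obtain ⟨D, hD⟩ := u.2 (Pi.single k j) (hsum.trans_le hj)
  obtain ⟨v, hv⟩ := exists_marginal hp₁ hp (Lp.memLp D) η k
  refine ⟨v, fun φ => ?_⟩
  have h := hD (tensorTest (Function.update η k φ))
  rw [hsum, multiDeriv_single, tensorTest_lineDeriv_iterate, Function.update_idem,
    Function.update_self] at h
  rw [hw, hv]
  exact h

end Marginals

/-! ### Product test functions separate `L^p` -/

section Density

open Filter Topology Metric

variable {𝕜 : Type*} [RCLike 𝕜] {d : ℕ} {Ω : Fin d → Opens ℝ}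

theorem exists_testFunction_bump {U : Opens ℝ} {c r R : ℝ} (hr : 0 < r) (hrR : r < R)
    (hU : closedBall c R ⊆ (U : Set ℝ)) : ∃ φ : 𝓓(U, ℝ),
      (∀ t ∈ closedBall c r, φ t = 1) ∧ (∀ t ∉ closedBall c R, φ t = 0) ∧
        ∀ t, 0 ≤ φ t ∧ φ t ≤ 1 := by
  let b : ContDiffBump c := ⟨r, R, hr, hrR⟩
  refine ⟨⟨b, b.contDiff, b.hasCompactSupport, b.tsupport_eq.trans_subset hU⟩,
    fun t ht => b.one_of_mem_closedBall ht, fun t ht => b.zero_of_le_dist ?_,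
    fun t => ⟨b.nonneg, b.le_one⟩⟩
  rw [mem_closedBall, not_le] at ht
  exact ht.le

theorem closedBall_apply_subset {x : Fin d → ℝ} {R : ℝ} (hR : 0 ≤ R)
    (h : closedBall x R ⊆ (productOpens Ω : Set (Fin d → ℝ))) (k : Fin d) :
    closedBall (x k) R ⊆ (Ω k : Set ℝ) := by
  intro t ht
  have hmem : Function.update x k t ∈ closedBall x R := by
    rw [closedBall_pi x hR]
    intro j _
    rcases eq_or_ne j k with rfl | hj
    · simpa using ht
    · simpa [hj] using hR
  simpa using mem_productOpens.mp (h hmem) k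

/-- Balls of the sup norm are cubes, so their indicators are limits of products of one-variable
bumps; dominated convergence passes to the limit. -/
theorem setIntegral_closedBall_eq_zero {U : (Fin d → ℝ) → 𝕜} (hU : LocallyIntegrable U volume)
    (h0 : ∀ φ : ∀ k, 𝓓(Ω k, ℝ), ∫ x, tensorTest φ x • U x = 0) {x : Fin d → ℝ} {r R : ℝ}
    (hr : 0 < r) (hrR : r < R) (hx : closedBall x R ⊆ (productOpens Ω : Set (Fin d → ℝ))) :
    ∫ y in closedBall x r, U y = 0 := by
  have hR : 0 ≤ R := (hr.trans hrR).le
  -- Outer radii decreasing to `r` from `ρ 0 = R`: the bumps equal 1 on the closed cube of radius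
  -- `r`, stay supported in that of radius `R`, and converge pointwise to the indicator of the
  -- former.
  set ρ : ℕ → ℝ := fun n => r + (R - r) / (n + 1) with hρ
  have hpos : ∀ n : ℕ, 0 < (R - r) / (n + 1) := fun n =>
    div_pos (sub_pos.mpr hrR) (Nat.cast_add_one_pos n)
  have hρR : ∀ n, ρ n ≤ R := fun n => by
    have := div_le_self (sub_pos.mpr hrR).le (by simp : (1 : ℝ) ≤ n + 1)
    simp only [hρ]
    linarith
  have hρlim : Tendsto ρ atTop (𝓝 r) := by
    have := (tendsto_const_div_atTop_nhds_zero_nat (R - r)).comp (tendsto_add_atTop_nat 1)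
    simpa [hρ, Function.comp_def] using this.const_add r
  choose φ hφ1 hφ0 hφ using fun (n : ℕ) (k : Fin d) => exists_testFunction_bump (U := Ω k) hr
    (by simpa [hρ] using hpos n : r < ρ n)
    ((closedBall_subset_closedBall (hρR n)).trans (closedBall_apply_subset hR hx k))
  have hzero : ∀ n y, (∃ k, y k ∉ closedBall (x k) (ρ n)) → tensorTest (φ n) y = 0 := by
    rintro n y ⟨k, hk⟩
    exact Finset.prod_eq_zero (Finset.mem_univ k) (hφ0 n k _ hk)
  have hlim : Tendsto (fun n => ∫ y, tensorTest (φ n) y • U y) atTop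
      (𝓝 (∫ y, (closedBall x r).indicator U y)) := by
    refine tendsto_integral_of_dominated_convergence
      ((closedBall x R).indicator fun y => ‖U y‖)
      (fun n => (tensorTest (φ n)).continuous.aestronglyMeasurable.smul hU.aestronglyMeasurable)
      (IntegrableOn.integrable_indicator
        (hU.integrableOn_isCompact (isCompact_closedBall x R)).norm measurableSet_closedBall) (fun n => Eventually.of_forall fun y => ?_)
      (Eventually.of_forall fun y => ?_)
    · by_cases hy : y ∈ closedBall x R
      · rw [Set.indicator_of_mem hy, norm_smul, tensorTest_apply]
        refine mul_le_of_le_one_left (norm_nonneg _) ?_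
        rw [norm_prod]
        refine Finset.prod_le_one (fun _ _ => norm_nonneg _) fun k _ => ?_
        rw [Real.norm_of_nonneg (hφ n k _).1]
        exact (hφ n k _).2
      · rw [hzero n y, zero_smul, norm_zero]
        · exact Set.indicator_nonneg (fun _ _ => norm_nonneg _) _
        · rw [closedBall_pi x hR] at hy
          simp only [Set.mem_univ_pi, not_forall] at hy
          exact hy.imp fun k hk h => hk (closedBall_subset_closedBall (hρR n) h)
    · by_cases hy : y ∈ closedBall x r
      · rw [Set.indicator_of_mem hy]
        rw [closedBall_pi x hr.le, Set.mem_univ_pi] at hy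
        refine tendsto_const_nhds.congr fun n => ?_
        rw [tensorTest_apply, Finset.prod_eq_one fun k _ => hφ1 n k _ (hy k), one_smul]
      · rw [Set.indicator_of_notMem hy]
        rw [closedBall_pi x hr.le] at hy
        simp only [Set.mem_univ_pi, not_forall, mem_closedBall, not_le] at hy
        obtain ⟨k, hk⟩ := hy
        refine tendsto_const_nhds.congr' ?_
        filter_upwards [hρlim.eventually_lt_const hk] with n hn
        rw [hzero n y ⟨k, by simpa using hn⟩, zero_smul]
  simp only [h0] at hlim
  rw [← integral_indicator measurableSet_closedBall]
  exact tendsto_nhds_unique hlim tendsto_const_nhds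

/-- By Lebesgue differentiation, `U x` is almost everywhere the limit of averages over small cubes
centred at `x`, and these averages vanish. -/
theorem ae_eq_zero_of_forall_integral_tensorTest_eq_zero {U : (Fin d → ℝ) → 𝕜}
    (hU : LocallyIntegrable U volume)
    (h0 : ∀ φ : ∀ k, 𝓓(Ω k, ℝ), ∫ x, tensorTest φ x • U x = 0) :
    ∀ᵐ x, x ∈ (productOpens Ω : Set (Fin d → ℝ)) → U x = 0 := by
  filter_upwards [IsUnifLocDoublingMeasure.ae_tendsto_average (volume : Measure (Fin d → ℝ)) hU 1]
    with x hx hxΩ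
  obtain ⟨R, hR, hRΩ⟩ := nhds_basis_closedBall.mem_iff.mp
    ((productOpens Ω).isOpen.mem_nhds hxΩ)
  have hlim := hx (l := 𝓝[>] (0 : ℝ)) (fun _ => x) id tendsto_id (by
    filter_upwards [self_mem_nhdsWithin] with δ hδ
    simpa using (Set.mem_Ioi.mp hδ).le)
  refine tendsto_nhds_unique hlim (tendsto_const_nhds.congr' ?_)
  filter_upwards [Ioo_mem_nhdsGT hR] with δ hδ
  rw [setAverage_eq, id, setIntegral_closedBall_eq_zero hU h0 hδ.1 hδ.2 hRΩ, smul_zero]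

theorem ae_eq_of_forall_integral_tensorTest_eq {p : ℝ≥0∞} [Fact (1 ≤ p)] {u v : (Fin d → ℝ) → 𝕜}
    (hu : MemLp u p (volume.restrict (productOpens Ω : Set (Fin d → ℝ))))
    (hv : MemLp v p (volume.restrict (productOpens Ω : Set (Fin d → ℝ))))
    (h : ∀ φ : ∀ k, 𝓓(Ω k, ℝ),
      ∫ x in (productOpens Ω : Set (Fin d → ℝ)), tensorTest φ x • u x =
        ∫ x in (productOpens Ω : Set (Fin d → ℝ)), tensorTest φ x • v x) :
    u =ᵐ[volume.restrict (productOpens Ω : Set (Fin d → ℝ))] v := by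
  have hms := (productOpens Ω).isOpen.measurableSet
  -- Extension by zero makes the difference locally integrable on the whole space, where
  -- differentiation is applied.
  have hloc : LocallyIntegrable
      ((productOpens Ω : Set (Fin d → ℝ)).indicator (u - v)) volume :=
    ((memLp_indicator_iff_restrict hms).mpr (hu.sub hv)).locallyIntegrable Fact.out
  have h0 := ae_eq_zero_of_forall_integral_tensorTest_eq_zero (Ω := Ω) hloc fun φ => by
    calc ∫ x, tensorTest φ x • (productOpens Ω : Set (Fin d → ℝ)).indicator (u - v) x
        = ∫ x in (productOpens Ω : Set (Fin d → ℝ)),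
            (tensorTest φ x • u x - tensorTest φ x • v x) := by
          rw [← integral_indicator hms]
          congr 1
          funext x
          by_cases hx : x ∈ (productOpens Ω : Set (Fin d → ℝ)) <;> simp [hx, smul_sub]
      _ = 0 := by
          rw [integral_sub (hu.integrable_testFunction_smul _)
            (hv.integrable_testFunction_smul _), h, sub_self]
  filter_upwards [ae_restrict_of_ae h0, ae_restrict_mem hms] with x hx hxΩ
  have := hx hxΩ
  rw [Set.indicator_of_mem hxΩ] at this
  exact sub_eq_zero.mp this

end Density

/-! ### Exchange identities and weak closedness -/

section Minors

variable {𝕜 : Type*} [RCLike 𝕜]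

/-- Each element of `S` costs one exchange with a fresh copy of `g`: slot `a` of the mixed family
returns to `g a`, and that copy becomes `g` with only slot `a` taken from `f`. -/
theorem piecewise_mul_pow_card_eq_prod {ι R : Type*} [DecidableEq ι] [CommMonoid R] {F : ι → Type*}
    {l : (∀ i, F i) → R} (hl : ∀ f g k,
      l f * l g = l (Function.update f k (g k)) * l (Function.update g k (f k)))
    (f g : ∀ i, F i) (S : Finset ι) :
    l (S.piecewise f g) * l g ^ S.card = l g * ∏ k ∈ S, l (Function.update g k (f k)) := by
  induction S using Finset.induction_on with
  | empty => simp
  | insert a S ha ih =>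
    have h := hl ((insert a S).piecewise f g) g a
    rw [Finset.piecewise_insert, Function.update_idem, Function.update_self,
      Function.update_eq_self_iff.mpr (Finset.piecewise_eq_of_notMem _ _ _ ha).symm] at h
    rw [Finset.card_insert_of_notMem ha, Finset.prod_insert ha, Finset.piecewise_insert,
      pow_succ', ← mul_assoc, h, mul_right_comm, ih]
    ac_rfl

variable {d : ℕ} {Ω : Fin d → Opens ℝ} {m : ℕ} {p : ℝ≥0∞}

theorem SobolevSpace.norm_toLp_le {U : Opens (Fin d → ℝ)} [Fact (1 ≤ p)]
    (u : SobolevSpace 𝕜 U m p) : ‖u.toLp‖ ≤ ‖u‖ := by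
  rw [norm_eq_sum, ← weakDeriv_zero]
  exact Finset.single_le_sum (f := fun α => ‖u.weakDeriv α‖) (fun _ _ => norm_nonneg _)
    (Finset.mem_univ _)

/-- Integration against a test function, as a continuous linear functional on `H^{m,p}`. -/
theorem SobolevSpace.exists_clm_integral_smul (𝕜 : Type*) [RCLike 𝕜] {U : Opens (Fin d → ℝ)}
    (m : ℕ) (p : ℝ≥0∞) [Fact (1 ≤ p)] (φ : 𝓓(U, ℝ)) :
    ∃ L : SobolevSpace 𝕜 U m p →L[𝕜] 𝕜,
      ∀ u, L u = ∫ x in (U : Set (Fin d → ℝ)), φ x • u.toLp x := by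
  have hpq : p.HolderConjugate p.conjExponent := inferInstance
  have : p.conjExponent.HolderConjugate p := hpq.symm
  have : Fact (1 ≤ p.conjExponent) := ⟨this.one_le⟩
  have hφ : MemLp (fun x => (φ x : 𝕜)) p.conjExponent (volume.restrict (U : Set (Fin d → ℝ))) :=
    TestFunction.memLp_ofReal φ _ _
  refine ⟨(ContinuousLinearMap.lpPairing _ p.conjExponent p (ContinuousLinearMap.mul 𝕜 𝕜)
    (hφ.toLp _)).comp (toLp.mkContinuous 1 fun u => by simpa using norm_toLp_le u), fun u => ?_⟩
  rw [ContinuousLinearMap.comp_apply, ContinuousLinearMap.lpPairing_eq_integral]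
  refine integral_congr_ae (hφ.coeFn_toLp.mono fun x hx => ?_)
  simp [hx, RCLike.real_smul_eq_coe_mul]

theorem integral_tensorTest_smul_tensor (φ : ∀ k, 𝓓(Ω k, ℝ)) (w : Fin d → ℝ → 𝕜) :
    ∫ x in (productOpens Ω : Set (Fin d → ℝ)), tensorTest φ x • ∏ k, w k (x k) =
      ∏ k, ∫ t in (Ω k : Set ℝ), φ k t • w k t := by
  rw [restrict_productOpens, ← integral_fintype_prod_eq_prod]
  congr 1
  funext x
  simp_rw [tensorTest_apply, RCLike.real_smul_eq_coe_mul, Finset.prod_mul_distrib, map_prod]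

variable [Fact (1 ≤ p)]

theorem isTensor_iff_forall_integral (hp : p ≠ ∞) {u : SobolevSpace 𝕜 (productOpens Ω) m p}
    {w : ∀ k, Lp 𝕜 p (volume.restrict (Ω k : Set ℝ))} :
    IsTensor u w ↔ ∀ φ : ∀ k, 𝓓(Ω k, ℝ),
      ∫ x in (productOpens Ω : Set (Fin d → ℝ)), tensorTest φ x • u.toLp x =
        ∏ k, ∫ t in (Ω k : Set ℝ), φ k t • w k t := by
  have hp0 : p ≠ 0 := (zero_lt_one.trans_le (Fact.out : 1 ≤ p)).ne'
  constructor
  · intro h φ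
    rw [← integral_tensorTest_smul_tensor]
    exact integral_congr_ae (h.mono fun x hx => congrArg (tensorTest φ x • ·) hx)
  · intro h
    exact ae_eq_of_forall_integral_tensorTest_eq (Lp.memLp _) (memLp_tensor hp0 hp w)
      fun φ => (h φ).trans (integral_tensorTest_smul_tensor φ _).symm

/-- A factor is needed to carry the zero: for `d = 0` the empty product is 1. -/
theorem zero_mem_rankOneTensors [NeZero d] (hp : p ≠ ∞) :
    (0 : SobolevSpace 𝕜 (productOpens Ω) m p) ∈ rankOneTensors 𝕜 Ω m p := by
  have hz : ∀ {E : Type} [MeasurableSpace E] (μ : Measure E) (c : E → ℝ),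
      ∫ x, c x • (0 : Lp 𝕜 p μ) x ∂μ = 0 := fun μ c => by
    refine integral_eq_zero_of_ae ?_
    filter_upwards [Lp.coeFn_zero 𝕜 p μ] with x hx
    rw [hx, Pi.zero_apply, smul_zero]
  refine ⟨0, fun k j _ => ⟨0, isWeakDeriv_zero _ _⟩, (isTensor_iff_forall_integral hp).mpr ?_⟩
  intro φ
  rw [Finset.prod_eq_zero (Finset.mem_univ (0 : Fin d)) (hz _ _), map_zero]
  exact hz _ _

/-- Quadratic equations characterise rank one without mentioning the factors `w k`, so no limit of
factors has to be taken. -/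
theorem mem_rankOneTensors_iff_minors [NeZero d] (hp₁ : 1 < p) (hp : p < ∞)
    {L : 𝓓(productOpens Ω, ℝ) → SobolevSpace 𝕜 (productOpens Ω) m p →L[𝕜] 𝕜}
    (hL : ∀ φ u, L φ u = ∫ x in (productOpens Ω : Set (Fin d → ℝ)), φ x • u.toLp x)
    (u : SobolevSpace 𝕜 (productOpens Ω) m p) :
    u ∈ rankOneTensors 𝕜 Ω m p ↔ ∀ (f g : ∀ k, 𝓓(Ω k, ℝ)) (k : Fin d),
      L (tensorTest f) u * L (tensorTest g) u =
        L (tensorTest (Function.update f k (g k))) u *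
          L (tensorTest (Function.update g k (f k))) u := by
  constructor
  · rintro ⟨w, -, hw⟩ f g k
    rw [isTensor_iff_forall_integral hp.ne] at hw
    simp_rw [hL, hw]
    have key := fun f => prod_update_apply
      (fun j (φ : 𝓓(Ω j, ℝ)) => ∫ t in (Ω j : Set ℝ), φ t • w j t) f k
    rw [key, key, ← Finset.mul_prod_erase _ _ (Finset.mem_univ k),
      ← Finset.mul_prod_erase Finset.univ (fun j => ∫ t in (Ω j : Set ℝ), g j t • w j t)
        (Finset.mem_univ k)]
    ring
  · intro h
    by_cases h0 : ∀ g : ∀ k, 𝓓(Ω k, ℝ), L (tensorTest g) u = 0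
    · suffices hu : u = 0 by
        rw [hu]
        exact zero_mem_rankOneTensors hp.ne
      refine SobolevSpace.toLp_injective (Lp.ext ?_)
      refine ae_eq_of_forall_integral_tensorTest_eq (Lp.memLp _) (Lp.memLp _) fun φ => ?_
      rw [← hL, ← hL, h0, map_zero]
    · obtain ⟨g, hg⟩ := not_forall.mp h0
      set c := L (tensorTest g) u
      -- The product of the unscaled marginals, tested against `f`, is `c ^ (d - 1)` times the value
      -- of `u` at `f`. The correction `c ^ (1 - d)` is put into the single slot `0`.
      let a : Fin d → 𝕜 := fun k => if k = 0 then c * (c ^ d)⁻¹ else 1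
      choose w hw using fun k => exists_marginal hp₁ hp (Lp.memLp (a k • u).toLp) g k
      refine ⟨w, fun k => marginal_mem_sobolevOnLine hp₁ hp (a k • u) g k (hw k), ?_⟩
      rw [isTensor_iff_forall_integral hp.ne]
      intro f
      have hprod := piecewise_mul_pow_card_eq_prod (l := fun f => L (tensorTest f) u) h f g
        Finset.univ
      rw [Finset.piecewise_univ, Finset.card_univ, Fintype.card_fin] at hprod
      simp_rw [hw, ← hL, map_smul, smul_eq_mul, Finset.prod_mul_distrib]
      rw [Finset.prod_ite_eq' Finset.univ (0 : Fin d) fun _ => c * (c ^ d)⁻¹,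
        if_pos (Finset.mem_univ _), mul_right_comm, ← hprod,
        mul_inv_cancel_right₀ (pow_ne_zero d hg)]

theorem isClosed_toWeakSpace_rankOneTensors (Ω : Fin d → Opens ℝ) (m : ℕ) (hp₁ : 1 < p)
    (hp : p < ∞) :
    IsClosed (toWeakSpace 𝕜 (SobolevSpace 𝕜 (productOpens Ω) m p) '' rankOneTensors 𝕜 Ω m p) := by
  cases d with
  | zero =>
    -- For `d = 0` the exchange identities are vacuous, but the empty product leaves at most one
    -- tensor, and points are weakly closed.
    refine (Set.Subsingleton.image ?_ _).isClosed
    rintro u ⟨w, -, hw⟩ v ⟨w', -, hw'⟩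
    refine SobolevSpace.toLp_injective (Lp.ext (hw.trans (.trans ?_ hw'.symm)))
    exact Filter.Eventually.of_forall fun x => by simp
  | succ d =>
    choose L hL using SobolevSpace.exists_clm_integral_smul 𝕜 (U := productOpens Ω) m p
    -- Norm-continuous functionals are weakly continuous, hence so are products of two of them.
    have hc : ∀ φ, Continuous fun x : WeakSpace 𝕜 (SobolevSpace 𝕜 (productOpens Ω) m p) =>
        L φ ((toWeakSpace 𝕜 _).symm x) := fun φ => WeakBilin.eval_continuous _ (L φ)
    rw [LinearEquiv.image_eq_preimage_symm]
    have hset : (toWeakSpace 𝕜 (SobolevSpace 𝕜 (productOpens Ω) m p)).symm ⁻¹'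
        rankOneTensors 𝕜 Ω m p = {x | ∀ (f g : ∀ k, 𝓓(Ω k, ℝ)) (k : Fin (d + 1)),
          L (tensorTest f) ((toWeakSpace 𝕜 _).symm x) *
            L (tensorTest g) ((toWeakSpace 𝕜 _).symm x) =
          L (tensorTest (Function.update f k (g k))) ((toWeakSpace 𝕜 _).symm x) *
            L (tensorTest (Function.update g k (f k))) ((toWeakSpace 𝕜 _).symm x)} :=
      Set.ext fun x => mem_rankOneTensors_iff_minors hp₁ hp hL _
    rw [hset]
    simp only [Set.ofPred_forall]
    exact isClosed_iInter fun f => isClosed_iInter fun g => isClosed_iInter fun k =>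
      isClosed_eq ((hc _).mul (hc _)) ((hc _).mul (hc _))

end Minors

theorem mainTheorem4 {𝕜 : Type*} [RCLike 𝕜] {d : ℕ} (Ω : Fin d → Opens ℝ) (m : ℕ) (p : ℝ≥0∞)
    [Fact (1 ≤ p)] (hp₁ : 1 < p) (hp : p < ∞) :
    (∀ w : ∀ k, Lp 𝕜 p (volume.restrict (Ω k : Set ℝ)),
      (∀ k, w k ∈ sobolevOnLine 𝕜 (Ω k) m p) →
        ∃ u : SobolevSpace 𝕜 (productOpens Ω) m p, IsTensor u w) ∧
    IsClosed (toWeakSpace 𝕜 (SobolevSpace 𝕜 (productOpens Ω) m p) '' rankOneTensors 𝕜 Ω m p) := by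
  exact ⟨fun w hw => exists_isTensor hp.ne w hw, isClosed_toWeakSpace_rankOneTensors Ω m hp₁ hp⟩
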